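/- Let $a_0>0$. The Buckley--Osthus random graph process with parameter $a_0$ starts with a single node $1$ carrying a self-loop; for $i\ge 1$, given the graph on the nodes $1,\dots,i$, in which node $v$ has degree $d_i(v)$ (a self-loop counts twice), a new node $i+1$ arrives together with one edge, which joins it to $v\le i$ with probability $\frac{d_i(v)+a_0-1}{(a_0+1)i+a_0}$ and to itself with probability $\frac{a_0}{(a_0+1)i+a_0}$. Let $\mathcal D=[\varepsilon,M]\subset(0,\infty)$ and, for $n\ge 1$ and $a\in\mathcal D$, define the scaled log-likelihood of the graph on $n$ nodes, with degrees $d(v)=d_n(v)$, by $$\ell_n(a)=\frac1n\Bigl(\sum_{v:\,d(v)\ge2}\ \sum_{k=0}^{d(v)-2}\log(a+k)-\sum_{k=1}^n\log\Bigl(a+\frac{k-1}{k}\Bigr)\Bigr).$$ Assume that $a_0\in\mathcal D$. Then $\ell_n$ attains its maximum over $\mathcal D$ for every $n\ge1$, and for every choice of maximum likelihood estimates $\hat a_n\in\arg\max_{a\in\mathcal D}\ell_n(a)$, almost surely $\hat a_n\to a_0$ as $n\to\infty$. -/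

import Mathlib

open MeasureTheory Filter Topology

noncomputable section

namespace BuckleyOsthus

/-- The growing multigraph is encoded by the sequence `t` of its attachments: the nodes are
`0, 1, 2, …`, and when node `i` arrives it brings exactly one edge, which joins `i` to `t i`
(a self-loop if `t i = i`). The graph with `n` nodes has nodes `0, …, n - 1` and the `n` edges
`{i, t i}`, `i < n`. `degree t n v` is the degree of `v` in that graph: every edge contributes
one for each of its two ends that is `v`, so that a self-loop counts twice. -/
def degree (t : ℕ → ℕ) (n v : ℕ) : ℕ :=
  ∑ i ∈ Finset.range n, ((if i = v then 1 else 0) + (if t i = v then 1 else 0))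

/-- The attachment rule with parameter `a`: the probability that the new node `n`, arriving in the
graph with the `n` nodes `0, …, n - 1`, is attached to `v`. -/
def attachProb (a : ℝ) (t : ℕ → ℕ) (n v : ℕ) : ℝ :=
  if v < n then ((degree t n v : ℝ) + a - 1) / ((a + 1) * n + a)
  else if v = n then a / ((a + 1) * n + a)
  else 0

/-- `T` is (the attachment sequence of) a Buckley–Osthus random graph process with parameter `a`
under `μ`: it starts with a single node with a self-loop, and, given the graph with `n ≥ 1` nodes,
that is, given the first `n` attachments, node `n` is attached to `v` with
probability `attachProb a t n v`. -/
structure IsProcess {Ω : Type*} [MeasurableSpace Ω] (μ : Measure Ω) (a : ℝ)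
    (T : ℕ → Ω → ℕ) : Prop where
  measurable : ∀ n, Measurable (T n)
  start : ∀ᵐ ω ∂μ, T 0 ω = 0
  attach : ∀ n : ℕ, 1 ≤ n → ∀ (t : ℕ → ℕ) (v : ℕ),
    μ.real {ω | (∀ i < n, T i ω = t i) ∧ T n ω = v}
      = μ.real {ω | ∀ i < n, T i ω = t i} * attachProb a t n v

/-- The scaled log-likelihood of the graph with `n` nodes. Nodes of degree one contribute an empty
sum to the first term. -/
def logLik (t : ℕ → ℕ) (n : ℕ) (a : ℝ) : ℝ :=
  1 / (n : ℝ) *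
    (∑ v ∈ (Finset.range n).filter (fun v => 2 ≤ degree t n v),
        ∑ k ∈ Finset.range (degree t n v - 1), Real.log (a + k)
      - ∑ k ∈ Finset.Icc 1 n, Real.log (a + ((k : ℝ) - 1) / k))

/-- `b` is a maximum likelihood estimate over `[ε, M]` from the graph with `n` nodes. -/
def IsMLE (ε M : ℝ) (t : ℕ → ℕ) (n : ℕ) (b : ℝ) : Prop :=
  b ∈ Set.Icc ε M ∧ IsMaxOn (logLik t n) (Set.Icc ε M) b

end BuckleyOsthus

end

/-!
Let `D i` be the excess of the node chosen by attachment `i`: its degree minus one, counting the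
half-edge that the arriving node brings along. Node `v` of final degree `d` is chosen at excess
`0, 1, …, d - 2`, so, up to the factor `1 / n`, the log-likelihood at `a` is
`∑ i < n, (log (a + D i) - log (a + i / (i + 1)))` (`logLik_eq`) and the score is
`∑ i < n, (1 / (a + D i) - 1 / (a + i / (i + 1)))`. Consistency follows once, for each `δ > 0` and
all large `n`, the score is positive on `[ε, a₀ - δ]` and negative on `[a₀ + δ, M]`.

Two almost sure facts suffice for this. Both come from a strong law for the differences between
`g (D i)` and its conditional expectation given the past (`ae_tendsto_average_sub_compensator`),
which are bounded and orthogonal.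

* With `g k = 1 / (a₀ + k)` the conditional expectation is exactly `1 / (a₀ + i / (i + 1))`, because
  the weight `a₀ + k` cancels. Hence the average of `1 / (a₀ + D i)` tends to `1 / (a₀ + 1)`.
* With `g` the indicator of `0` the conditional expectation is controlled by the number of
  attachments with `D i = 0` so far, and this feedback forces the proportion of `i` with `D i = 0`
  to stay away from `0` and from `1` (`exists_zeroCount_bounds`).

The rest is deterministic. Let `h n a` be the harmonic mean of `a + D i`, `i < n`. The first fact
says `h n a₀ → a₀ + 1`, while the sign of the score at `a` is asymptotically that of
`a + 1 - h n a`. For `a < b` the difference quotient of `h n` is the ratio of the mean of a product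
to the product of the means for `1 / (a + D)` and `1 / (b + D)`. Both decrease in `D`, so by
Chebyshev's inequality it is at least one, and by the second fact it exceeds one by a fixed amount
(`harmonicMean_growth`). Thus `h n a - (a + 1)` increases in `a` at a rate bounded below and
vanishes asymptotically at `a₀` only, which gives the signs, uniformly in `a`.
-/

open MeasureTheory Filter Topology

namespace BuckleyOsthus

/-! ### Degrees -/

/-- The degree that node `v ≤ n` would have, minus one, when node `n` arrives and before the second
end of its edge is placed. The arriving node itself counts as having one half-edge, hence
excess `0`. In these terms the attachment weight of every `v ≤ n` is `excess t n v + a`. -/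
def excess (t : ℕ → ℕ) (n v : ℕ) : ℕ :=
  if v < n then degree t n v - 1 else 0

lemma degree_pos (t : ℕ → ℕ) {n v : ℕ} (hv : v < n) : 1 ≤ degree t n v := by
  unfold degree
  refine le_trans ?_ (Finset.single_le_sum (fun i _ => Nat.zero_le _) (Finset.mem_range.2 hv))
  simp

lemma degree_succ (t : ℕ → ℕ) (n v : ℕ) :
    degree t (n + 1) v
      = degree t n v + ((if n = v then 1 else 0) + (if t n = v then 1 else 0)) := by
  simp [degree, Finset.sum_range_succ]

lemma degree_self_eq_zero {t : ℕ → ℕ} (ht : ∀ i, t i ≤ i) (n : ℕ) : degree t n n = 0 := by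
  refine Finset.sum_eq_zero fun i hi => ?_
  have h1 := Finset.mem_range.1 hi
  have h2 := ht i
  simp [show i ≠ n by omega, show t i ≠ n by omega]

lemma attachProb_eq (a : ℝ) (t : ℕ → ℕ) {n v : ℕ} (hv : v ≤ n) :
    attachProb a t n v = ((excess t n v : ℝ) + a) / ((a + 1) * n + a) := by
  unfold attachProb excess
  rcases hv.lt_or_eq with h | rfl
  · have := degree_pos t h
    simp only [h, if_true]
    push_cast [Nat.cast_sub this]
    ring
  · simp

lemma attachProb_eq_zero (a : ℝ) (t : ℕ → ℕ) {n v : ℕ} (hv : n < v) : attachProb a t n v = 0 := by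
  simp [attachProb, show ¬ v < n by omega, show v ≠ n by omega]

/-- Summing over nodes is the same as summing over attachments: a node of final degree `d` was
chosen while its excess was `0, 1, …, d - 2`. -/
lemma sum_range_degree_eq {t : ℕ → ℕ} (ht : ∀ i, t i ≤ i) (φ : ℕ → ℝ) (n : ℕ) :
    ∑ v ∈ Finset.range n, ∑ k ∈ Finset.range (degree t n v - 1), φ k
      = ∑ i ∈ Finset.range n, φ (excess t i (t i)) := by
  induction n with
  | zero => simp
  | succ n ih =>
    have key : ∀ v ∈ Finset.range (n + 1),
        ∑ k ∈ Finset.range (degree t (n + 1) v - 1), φ k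
          = ∑ k ∈ Finset.range (excess t n v), φ k
            + if t n = v then φ (excess t n v) else 0 := by
      intro v hv
      have hdeg : degree t (n + 1) v - 1 = excess t n v + if t n = v then 1 else 0 := by
        rw [degree_succ, excess]
        rcases (Nat.lt_succ_iff.1 (Finset.mem_range.1 hv)).lt_or_eq with h | rfl
        · have := degree_pos t h
          simp only [h, if_true, show n ≠ v by omega, if_false]
          omega
        · simp [degree_self_eq_zero ht]
      rw [hdeg]
      split_ifs
      · rw [Finset.sum_range_succ]
      · simp
    rw [Finset.sum_congr rfl key, Finset.sum_add_distrib, Finset.sum_ite_eq,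
      if_pos (Finset.mem_range.2 (Nat.lt_succ_iff.2 (ht n))), Finset.sum_range_succ (n := n),
      Finset.sum_range_succ (n := n), ← ih]
    congr 1
    rw [show excess t n n = 0 by simp [excess], Finset.range_zero, Finset.sum_empty, add_zero]
    refine Finset.sum_congr rfl fun v hv => ?_
    rw [excess, if_pos (Finset.mem_range.1 hv)]

/-- The number of attachments among the first `n` that chose a node of excess zero. -/
def zeroCount (t : ℕ → ℕ) (n : ℕ) : ℝ :=
  ∑ i ∈ Finset.range n, if excess t i (t i) = 0 then 1 else 0

/-- Every attachment either leaves one more node of excess zero or uses one up, so among the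
`n + 1` candidates for the `n`-th attachment exactly `n + 1 - zeroCount t n` have excess zero. -/
lemma sum_excess_eq_zero {t : ℕ → ℕ} (ht : ∀ i, t i ≤ i) (n : ℕ) :
    ∑ v ∈ Finset.range (n + 1), (if excess t n v = 0 then (1 : ℝ) else 0)
      = n + 1 - zeroCount t n := by
  rw [zeroCount, ← sum_range_degree_eq ht (fun k => if k = 0 then (1 : ℝ) else 0),
    Finset.sum_range_succ, eq_sub_iff_add_eq, add_right_comm, ← Finset.sum_add_distrib]
  have h1 : ∀ v ∈ Finset.range n, ((if excess t n v = 0 then (1 : ℝ) else 0)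
      + ∑ k ∈ Finset.range (degree t n v - 1), if k = 0 then (1 : ℝ) else 0) = 1 := by
    intro v hv
    rw [Finset.sum_ite_eq', excess, if_pos (Finset.mem_range.1 hv)]
    by_cases h : degree t n v - 1 = 0
    · simp [h]
    · rw [if_neg h, if_pos (Finset.mem_range.2 (Nat.pos_of_ne_zero h)), zero_add]
  rw [Finset.sum_congr rfl h1]
  simp [excess]

/-- The log-likelihood as a sum over attachments. -/
lemma logLik_eq {t : ℕ → ℕ} (ht : ∀ i, t i ≤ i) (n : ℕ) (x : ℝ) :
    logLik t n x = 1 / (n : ℝ) * ∑ i ∈ Finset.range n,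
      (Real.log (x + excess t i (t i)) - Real.log (x + (i : ℝ) / (i + 1))) := by
  have h1 : ∑ v ∈ (Finset.range n).filter (fun v => 2 ≤ degree t n v),
        ∑ k ∈ Finset.range (degree t n v - 1), Real.log (x + k)
      = ∑ v ∈ Finset.range n, ∑ k ∈ Finset.range (degree t n v - 1), Real.log (x + k) := by
    refine Finset.sum_filter_of_ne fun v _ hne => ?_
    by_contra hlt
    rw [show degree t n v - 1 = 0 by omega] at hne
    simp at hne
  have h2 : ∑ k ∈ Finset.Icc 1 n, Real.log (x + ((k : ℝ) - 1) / k)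
      = ∑ i ∈ Finset.range n, Real.log (x + (i : ℝ) / (i + 1)) := by
    induction n with
    | zero => simp
    | succ n ih =>
      rw [Finset.sum_Icc_succ_top (by omega), Finset.sum_range_succ, ih]
      · push_cast; simp
      · refine Finset.sum_filter_of_ne fun v _ hne => ?_
        by_contra hlt
        rw [show degree t n v - 1 = 0 by omega] at hne
        simp at hne
  rw [logLik, h1, h2, sum_range_degree_eq ht (fun k => Real.log (x + k)), Finset.sum_sub_distrib]

/-! ### Existence of maximum likelihood estimates -/

lemma continuousOn_logLik {ε M : ℝ} (hε : 0 < ε) (t : ℕ → ℕ) (n : ℕ) :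
    ContinuousOn (logLik t n) (Set.Icc ε M) := by
  unfold logLik
  refine continuousOn_const.mul (ContinuousOn.sub ?_ ?_)
  · refine continuousOn_finsetSum _ fun v _ => continuousOn_finsetSum _ fun k _ => ?_
    refine ContinuousOn.log (by fun_prop) fun x hx => ne_of_gt ?_
    have h1 : (0 : ℝ) ≤ k := k.cast_nonneg
    have := hx.1
    linarith
  · refine continuousOn_finsetSum _ fun k hk => ?_
    refine ContinuousOn.log (by fun_prop) fun x hx => ne_of_gt ?_
    have h1 : (1 : ℝ) ≤ k := by exact_mod_cast (Finset.mem_Icc.1 hk).1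
    have h2 : 0 ≤ ((k : ℝ) - 1) / k := div_nonneg (by linarith) (by linarith)
    have := hx.1
    linarith

lemma exists_isMLE {ε M : ℝ} (hε : 0 < ε) (hεM : ε ≤ M) (t : ℕ → ℕ) (n : ℕ) :
    ∃ b, IsMLE ε M t n b :=
  isCompact_Icc.exists_isMaxOn (Set.nonempty_Icc.2 hεM) (continuousOn_logLik hε t n)

/-! ### The sign of the score -/

lemma hasDerivAt_logLik {t : ℕ → ℕ} (ht : ∀ i, t i ≤ i) (n : ℕ) {x : ℝ} (hx : 0 < x) :
    HasDerivAt (logLik t n) (1 / (n : ℝ) * (∑ i ∈ Finset.range n, 1 / (x + excess t i (t i))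
      - ∑ i ∈ Finset.range n, 1 / (x + (i : ℝ) / (i + 1)))) x := by
  rw [show logLik t n = _ from funext (logLik_eq ht n), ← Finset.sum_sub_distrib]
  refine HasDerivAt.const_mul _ (HasDerivAt.fun_sum fun i _ => HasDerivAt.sub ?_ ?_)
  · have h : x + (excess t i (t i) : ℝ) ≠ 0 := by positivity
    exact ((hasDerivAt_id x).add_const (excess t i (t i) : ℝ)).log h
  · have h : x + (i : ℝ) / (i + 1) ≠ 0 := by positivity
    exact ((hasDerivAt_id x).add_const ((i : ℝ) / (i + 1))).log h

/-- The harmonic mean `n / ∑ 1 / (a + D i)` of the numbers `a + D i`, `i < n`, grows with `a` at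
rate at least one, and strictly faster when a positive proportion of the `D i` vanish
and a positive proportion do not. The excess rate is the empirical covariance of `1 / (a + D)` and
`1 / (b + D)`, here bounded below through the pairs with `D i = 0 < D j`. -/
lemma harmonicMean_growth {ε M a b c₁ c₂ : ℝ} (hε : 0 < ε) (ha : ε ≤ a) (hab : a ≤ b) (hb : b ≤ M)
    (D : ℕ → ℕ) {n : ℕ} (hn : 0 < n) (hc₁ : 0 ≤ c₁) (hc₂ : 0 ≤ c₂)
    (h₁ : c₁ * n ≤ ∑ i ∈ Finset.range n, if D i = 0 then (1 : ℝ) else 0)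
    (h₂ : c₂ * n ≤ n - ∑ i ∈ Finset.range n, if D i = 0 then (1 : ℝ) else 0) :
    (b - a) * (1 + c₁ * c₂ * (1 / (M * (M + 1))) ^ 2 * ε ^ 2)
      ≤ n / (∑ i ∈ Finset.range n, 1 / (b + D i)) - n / (∑ i ∈ Finset.range n, 1 / (a + D i)) := by
  have ha0 : 0 < a := hε.trans_le ha
  have hb0 : 0 < b := ha0.trans_le hab
  have hM0 : 0 < M := hb0.trans_le hb
  have hnR : (0 : ℝ) < n := by exact_mod_cast hn
  have hne : (Finset.range n).Nonempty := Finset.nonempty_range_iff.2 hn.ne'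
  set A := ∑ i ∈ Finset.range n, 1 / (a + D i) with hA
  set B := ∑ i ∈ Finset.range n, 1 / (b + D i) with hB
  set W := ∑ i ∈ Finset.range n, 1 / (a + D i) * (1 / (b + D i)) with hW
  set I : ℕ → ℝ := fun i => if D i = 0 then (1 : ℝ) else 0 with hI
  set Z := ∑ i ∈ Finset.range n, I i with hZ
  set κ := (1 / (M * (M + 1))) ^ 2 with hκ
  have hA0 : 0 < A := Finset.sum_pos (fun i _ => by positivity) hne
  have hB0 : 0 < B := Finset.sum_pos (fun i _ => by positivity) hne
  have hle : ∀ x, ε ≤ x → ∑ i ∈ Finset.range n, 1 / (x + D i) ≤ n / ε := by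
    intro x hx
    calc ∑ i ∈ Finset.range n, 1 / (x + D i) ≤ ∑ i ∈ Finset.range n, 1 / ε := by
          refine Finset.sum_le_sum fun i _ => one_div_le_one_div_of_le hε ?_
          have : (0 : ℝ) ≤ D i := Nat.cast_nonneg _
          linarith
      _ = n / ε := by simp [div_eq_mul_inv]
  have hAB : A * B * ε ^ 2 ≤ n ^ 2 := by
    have h1 : A * ε ≤ n := (le_div_iff₀ hε).1 (hle a ha)
    have h2 : B * ε ≤ n := (le_div_iff₀ hε).1 (hle b (ha.trans hab))
    calc A * B * ε ^ 2 = (A * ε) * (B * ε) := by ring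
      _ ≤ n * n := by gcongr
      _ = _ := by ring
  have hdiff : A - B = (b - a) * W := by
    rw [hA, hB, hW, ← Finset.sum_sub_distrib, Finset.mul_sum]
    refine Finset.sum_congr rfl fun i _ => ?_
    field_simp
    ring
  have gap : ∀ x, 0 < x → x ≤ M → ∀ k : ℕ, k ≠ 0 →
      1 / (M * (M + 1)) ≤ 1 / x - 1 / (x + k) := by
    intro x hx hxM k hk
    have hk1 : (1 : ℝ) ≤ k := by exact_mod_cast Nat.one_le_iff_ne_zero.2 hk
    have h1 : 1 / (x + k) ≤ 1 / (x + 1) := one_div_le_one_div_of_le (by linarith) (by linarith)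
    have h2 : 1 / x - 1 / (x + 1) = 1 / (x * (x + 1)) := by field_simp; ring
    have h3 : 1 / (M * (M + 1)) ≤ 1 / (x * (x + 1)) :=
      one_div_le_one_div_of_le (by positivity) (by gcongr)
    linarith
  have hpair : ∀ i j, κ * (I i * (1 - I j) + I j * (1 - I i))
      ≤ (1 / (a + D i) - 1 / (a + D j)) * (1 / (b + D i) - 1 / (b + D j)) := by
    have hK : 0 ≤ 1 / (M * (M + 1)) := by positivity
    intro i j
    simp only [hI]
    by_cases hi : D i = 0 <;> by_cases hj : D j = 0
    · simp [hi, hj]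
    · have g1 := gap a ha0 (hab.trans hb) _ hj
      have g2 := gap b hb0 hb _ hj
      simp only [hi, hj, if_true, if_false, Nat.cast_zero, add_zero]
      have := mul_le_mul g1 g2 hK (hK.trans g1)
      rw [hκ]; linarith
    · have g1 := gap a ha0 (hab.trans hb) _ hi
      have g2 := gap b hb0 hb _ hi
      simp only [hi, hj, if_true, if_false, Nat.cast_zero, add_zero]
      have := mul_le_mul g1 g2 hK (hK.trans g1)
      rw [hκ]; linarith
    · simp only [hi, hj, if_false]
      -- both factors have the sign of `D j - D i`
      have : 0 ≤ (1 / (a + D i) - 1 / (a + D j)) * (1 / (b + D i) - 1 / (b + D j)) := by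
        rcases le_total (D i) (D j) with h | h
        · have h' : (D i : ℝ) ≤ D j := by exact_mod_cast h
          exact mul_nonneg
            (sub_nonneg.2 (one_div_le_one_div_of_le (by positivity) (by linarith)))
            (sub_nonneg.2 (one_div_le_one_div_of_le (by positivity) (by linarith)))
        · have h' : (D j : ℝ) ≤ D i := by exact_mod_cast h
          exact mul_nonneg_of_nonpos_of_nonpos
            (sub_nonpos.2 (one_div_le_one_div_of_le (by positivity) (by linarith)))
            (sub_nonpos.2 (one_div_le_one_div_of_le (by positivity) (by linarith)))
      linarith
  have hcov : κ * (Z * (n - Z)) ≤ n * W - A * B := by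
    have h := Finset.sum_le_sum fun i (_ : i ∈ Finset.range n) =>
      Finset.sum_le_sum fun j (_ : j ∈ Finset.range n) => hpair i j
    have hl : ∑ i ∈ Finset.range n, ∑ j ∈ Finset.range n,
        κ * (I i * (1 - I j) + I j * (1 - I i)) = 2 * (κ * (Z * (n - Z))) := by
      simp only [mul_add, mul_sub, mul_one, Finset.sum_add_distrib, Finset.sum_sub_distrib,
        ← Finset.mul_sum, ← Finset.sum_mul, Finset.sum_const, Finset.card_range, nsmul_eq_mul]
      rw [← hZ]; ring
    have hr : ∑ i ∈ Finset.range n, ∑ j ∈ Finset.range n,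
        (1 / (a + D i) - 1 / (a + D j)) * (1 / (b + D i) - 1 / (b + D j))
          = 2 * (n * W - A * B) := by
      have hinner : ∀ i, ∑ j ∈ Finset.range n,
          (1 / (a + D i) - 1 / (a + D j)) * (1 / (b + D i) - 1 / (b + D j))
            = n * (1 / (a + D i) * (1 / (b + D i))) + W
              - (1 / (a + D i) * B + 1 / (b + D i) * A) := by
        intro i
        rw [hW, hA, hB, Finset.mul_sum, Finset.mul_sum, ← Finset.sum_add_distrib,
          show (n : ℝ) * (1 / (a + D i) * (1 / (b + D i)))
            = ∑ j ∈ Finset.range n, 1 / (a + D i) * (1 / (b + D i)) by simp,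
          ← Finset.sum_add_distrib, ← Finset.sum_sub_distrib]
        exact Finset.sum_congr rfl fun j _ => by ring
      rw [Finset.sum_congr rfl fun i _ => hinner i, Finset.sum_sub_distrib,
        Finset.sum_add_distrib, Finset.sum_add_distrib, ← Finset.mul_sum, ← Finset.sum_mul,
        ← Finset.sum_mul, ← hA, ← hB, ← hW, Finset.sum_const, Finset.card_range, nsmul_eq_mul]
      ring
    rw [hl, hr] at h
    linarith
  have hZZ : c₁ * c₂ * n ^ 2 ≤ Z * (n - Z) := by
    calc c₁ * c₂ * n ^ 2 = (c₁ * n) * (c₂ * n) := by ring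
      _ ≤ Z * (n - Z) := mul_le_mul h₁ h₂ (by positivity) (le_trans (by positivity) h₁)
  have hfinal : (1 + c₁ * c₂ * κ * ε ^ 2) * (A * B) ≤ n * W := by
    have e1 : c₁ * c₂ * κ * (A * B * ε ^ 2) ≤ c₁ * c₂ * κ * n ^ 2 := by gcongr
    have e2 : κ * (c₁ * c₂ * n ^ 2) ≤ κ * (Z * (n - Z)) := by gcongr
    linarith
  have hquot : n / B - n / A = (b - a) * (n * W / (A * B)) := by
    rw [div_sub_div _ _ hB0.ne' hA0.ne', ← mul_div_assoc, mul_comm B A, mul_comm B, ← mul_sub,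
      hdiff]
    ring
  rw [hquot]
  exact mul_le_mul_of_nonneg_left ((le_div_iff₀ (by positivity)).2 hfinal) (sub_nonneg.2 hab)

/-! ### A strong law for orthogonal bounded increments -/

/-- Second moments give almost sure convergence along the squares, and since the increments are
bounded the averages cannot move much between consecutive squares. -/
lemma ae_tendsto_average_zero {Ω : Type*} [MeasurableSpace Ω] {μ : Measure Ω}
    [IsProbabilityMeasure μ] {ξ : ℕ → Ω → ℝ} {C : ℝ} (hmeas : ∀ n, Measurable (ξ n))
    (hb : ∀ n ω, |ξ n ω| ≤ C)
    (horth : ∀ n, ∫ ω, (∑ i ∈ Finset.range n, ξ i ω) * ξ n ω ∂μ = 0) :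
    ∀ᵐ ω ∂μ, Tendsto (fun n : ℕ => (∑ i ∈ Finset.range n, ξ i ω) / n) atTop (𝓝 0) := by
  set S : ℕ → Ω → ℝ := fun n ω => ∑ i ∈ Finset.range n, ξ i ω with hS
  have hSm : ∀ n, Measurable (S n) := fun n => Finset.measurable_fun_sum _ fun i _ => hmeas i
  have hSb : ∀ n ω, |S n ω| ≤ n * C := fun n ω => by
    calc |S n ω| ≤ ∑ i ∈ Finset.range n, |ξ i ω| := Finset.abs_sum_le_sum_abs _ _
      _ ≤ ∑ i ∈ Finset.range n, C := Finset.sum_le_sum fun i _ => hb i ω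
      _ = n * C := by simp
  have hint : ∀ {f g : Ω → ℝ} {A B : ℝ}, Measurable f → Measurable g → (∀ ω, |f ω| ≤ A) →
      (∀ ω, |g ω| ≤ B) → Integrable (fun ω => f ω * g ω) μ := by
    intro f g A B hf hg hA hB
    refine Integrable.of_bound (hf.mul hg).aestronglyMeasurable (A * B) (ae_of_all _ fun ω => ?_)
    rw [Real.norm_eq_abs, abs_mul]
    exact mul_le_mul (hA ω) (hB ω) (abs_nonneg _) ((abs_nonneg _).trans (hA ω))
  have hvar : ∀ n, ∫ ω, S n ω * S n ω ∂μ ≤ n * C ^ 2 := by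
    intro n
    induction n with
    | zero => simp [hS]
    | succ n ih =>
      have h1 : ∀ ω, S (n + 1) ω * S (n + 1) ω
          = S n ω * S n ω + 2 * (S n ω * ξ n ω) + ξ n ω * ξ n ω := fun ω => by
        simp only [hS, Finset.sum_range_succ]; ring
      have i1 := hint (hSm n) (hSm n) (hSb n) (hSb n)
      have i2 := hint (hSm n) (hmeas n) (hSb n) (hb n)
      have i3 := hint (hmeas n) (hmeas n) (hb n) (hb n)
      have h3 : ∫ ω, ξ n ω * ξ n ω ∂μ ≤ C ^ 2 := by
        calc ∫ ω, ξ n ω * ξ n ω ∂μ ≤ ∫ _, C ^ 2 ∂μ :=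
              integral_mono i3 (integrable_const _) fun ω => by
                have := sq_le_sq' (abs_le.1 (hb n ω)).1 (abs_le.1 (hb n ω)).2
                simpa [sq] using this
          _ = C ^ 2 := by simp
      simp_rw [h1]
      have i12 : Integrable (fun ω => S n ω * S n ω + 2 * (S n ω * ξ n ω)) μ :=
        i1.add (i2.const_mul 2)
      rw [integral_add i12 i3, integral_add i1 (i2.const_mul 2),
        integral_const_mul, show ∫ ω, S n ω * ξ n ω ∂μ = 0 from horth n]
      push_cast
      linarith
  have hsq : ∀ᵐ ω ∂μ, Tendsto (fun n : ℕ => |S (n ^ 2) ω| / (n : ℝ) ^ 2) atTop (𝓝 0) := by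
    have hY : ∀ n : ℕ, Measurable fun ω => ENNReal.ofReal ((S (n ^ 2) ω / (n : ℝ) ^ 2) ^ 2) :=
      fun n => (((hSm _).div_const _).pow_const 2).ennreal_ofReal
    have hfin : ∫⁻ ω, ∑' n : ℕ, ENNReal.ofReal ((S (n ^ 2) ω / (n : ℝ) ^ 2) ^ 2) ∂μ ≠ ⊤ := by
      rw [lintegral_tsum fun n => (hY n).aemeasurable]
      have hsum : Summable fun n : ℕ => C ^ 2 * (1 / (n : ℝ) ^ 2) :=
        (Real.summable_one_div_nat_pow.2 one_lt_two).mul_left _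
      refine ne_top_of_le_ne_top hsum.tsum_ofReal_ne_top (ENNReal.tsum_le_tsum fun n => ?_)
      have heq : ∀ ω, (S (n ^ 2) ω / (n : ℝ) ^ 2) ^ 2
          = (1 / (n : ℝ) ^ 4) * (S (n ^ 2) ω * S (n ^ 2) ω) := fun ω => by ring
      rw [← ofReal_integral_eq_lintegral_ofReal _ (ae_of_all _ fun ω => sq_nonneg _)]
      · refine ENNReal.ofReal_le_ofReal ?_
        simp_rw [heq]
        rw [integral_const_mul]
        refine (mul_le_mul_of_nonneg_left (hvar (n ^ 2)) (by positivity)).trans_eq ?_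
        rcases Nat.eq_zero_or_pos n with rfl | hn
        · simp
        · push_cast; field_simp
      · simp_rw [heq]
        exact (hint (hSm _) (hSm _) (hSb _) (hSb _)).const_mul _
    filter_upwards [ae_lt_top (Measurable.tsum hY) hfin] with ω hω
    have h1 := ENNReal.tendsto_atTop_zero_of_tsum_ne_top hω.ne
    have h2 := (ENNReal.tendsto_toReal ENNReal.zero_ne_top).comp h1
    have h3 := (Real.continuous_sqrt.tendsto _).comp h2
    simp only [ENNReal.toReal_zero, Real.sqrt_zero] at h3
    refine h3.congr fun n => ?_
    simp only [Function.comp]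
    rw [ENNReal.toReal_ofReal (sq_nonneg _), Real.sqrt_sq_eq_abs, abs_div,
      abs_of_nonneg (by positivity : (0 : ℝ) ≤ (n : ℝ) ^ 2)]
  filter_upwards [hsq] with ω hω
  have hsqrt : Tendsto Nat.sqrt atTop atTop :=
    tendsto_atTop_atTop.2 fun b => ⟨b * b, fun m hm => Nat.le_sqrt.2 hm⟩
  have hlim : Tendsto (fun n : ℕ => |S (n ^ 2) ω| / (n : ℝ) ^ 2 + 2 * C / n) atTop (𝓝 0) := by
    simpa using hω.add (tendsto_const_div_atTop_nhds_zero_nat (2 * C))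
  refine squeeze_zero_norm' ?_ (hlim.comp hsqrt)
  filter_upwards [eventually_ge_atTop 1] with m hm
  set n := Nat.sqrt m with hn
  have hn0 : 0 < n := Nat.sqrt_pos.2 hm
  have hnm : n ^ 2 ≤ m := Nat.sqrt_le' m
  have hmn : m ≤ n ^ 2 + 2 * n := by have := Nat.sqrt_le_add m; rw [← hn] at this; nlinarith
  have hC : 0 ≤ C := (abs_nonneg _).trans (hb 0 ω)
  have hinc : |S m ω - S (n ^ 2) ω| ≤ 2 * n * C := by
    have : S m ω - S (n ^ 2) ω = ∑ i ∈ Finset.Ico (n ^ 2) m, ξ i ω :=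
      (Finset.sum_Ico_eq_sub _ hnm).symm
    rw [this]
    calc _ ≤ ∑ i ∈ Finset.Ico (n ^ 2) m, |ξ i ω| := Finset.abs_sum_le_sum_abs _ _
      _ ≤ ∑ i ∈ Finset.Ico (n ^ 2) m, C := Finset.sum_le_sum fun i _ => hb i ω
      _ = ((m - n ^ 2 : ℕ) : ℝ) * C := by simp
      _ ≤ ((2 * n : ℕ) : ℝ) * C := by gcongr; omega
      _ = 2 * n * C := by push_cast; ring
  have hnR : (0 : ℝ) < n := by exact_mod_cast hn0
  have hnmR : (n : ℝ) ^ 2 ≤ m := by exact_mod_cast hnm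
  have hSm' : |S m ω| ≤ |S (n ^ 2) ω| + 2 * n * C := by
    have := abs_sub_abs_le_abs_sub (S m ω) (S (n ^ 2) ω)
    linarith
  rw [Real.norm_eq_abs, abs_div, Nat.abs_cast]
  calc |S m ω| / m ≤ (|S (n ^ 2) ω| + 2 * n * C) / (n : ℝ) ^ 2 := by gcongr
    _ = |S (n ^ 2) ω| / (n : ℝ) ^ 2 + 2 * C / n := by field_simp

/-! ### Functionals of the history of the process -/

section AttachmentLaw

variable {Ω : Type*} [MeasurableSpace Ω] {μ : Measure Ω} {a : ℝ} {T : ℕ → Ω → ℕ}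

lemma degree_congr {n : ℕ} {t t' : ℕ → ℕ} (h : ∀ i ∈ Set.Iio n, t i = t' i) (v : ℕ) :
    degree t n v = degree t' n v :=
  Finset.sum_congr rfl fun i hi => by rw [h i (Finset.mem_range.1 hi)]

/-- The first `n` attachments, continued by zeros. -/
def extendHistory (n : ℕ) (h : Fin n → ℕ) (i : ℕ) : ℕ :=
  if hi : i < n then h ⟨i, hi⟩ else 0

lemma measurable_of_dependsOn (hT : ∀ n, Measurable (T n)) {n : ℕ} {Φ : (ℕ → ℕ) → ℝ}
    (hΦ : DependsOn Φ (Set.Iio n)) : Measurable fun ω => Φ fun i => T i ω := by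
  have h1 : Measurable fun ω => fun i : Fin n => T i ω := measurable_pi_lambda _ fun i => hT i
  have h2 : (fun ω => Φ fun i => T i ω)
      = (fun h => Φ (extendHistory n h)) ∘ fun ω => fun i : Fin n => T i ω := by
    funext ω
    refine hΦ fun i hi => ?_
    simp [extendHistory, Set.mem_Iio.1 hi]
  rw [h2]
  exact Measurable.of_discrete.comp h1

lemma ae_attach_le [IsProbabilityMeasure μ] (hT : IsProcess μ a T) :
    ∀ᵐ ω ∂μ, ∀ n, T n ω ≤ n := by
  refine ae_all_iff.2 fun n => ?_
  rcases Nat.eq_zero_or_pos n with rfl | hn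
  · filter_upwards [hT.start] with ω hω using hω.le
  have hnull : ∀ (h : Fin n → ℕ) (v : ℕ), n < v →
      ∀ᵐ ω ∂μ, ¬ ((∀ i < n, T i ω = extendHistory n h i) ∧ T n ω = v) := by
    intro h v hv
    have := hT.attach n hn (extendHistory n h) v
    rw [attachProb_eq_zero a _ hv, mul_zero, measureReal_eq_zero_iff] at this
    simpa [ae_iff] using this
  have hall : ∀ᵐ ω ∂μ, ∀ (h : Fin n → ℕ) (v : ℕ), n < v →
      ¬ ((∀ i < n, T i ω = extendHistory n h i) ∧ T n ω = v) :=
    ae_all_iff.2 fun h => ae_all_iff.2 fun v => eventually_imp_distrib_left.2 (hnull h v)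
  filter_upwards [hall] with ω hω
  by_contra hlt
  refine hω (fun i => T i ω) (T n ω) (not_le.1 hlt) ⟨fun i hi => ?_, rfl⟩
  simp [extendHistory, hi]

/-- Given the first `n` attachments, `attachProb` is the law of the next one: a function of the
`n`-th attachment minus its average under `attachProb` is orthogonal to every bounded function of
the history. -/
lemma integral_mul_centered_eq_zero [IsProbabilityMeasure μ] (hT : IsProcess μ a T) {n : ℕ}
    (hn : 1 ≤ n) {Φ : (ℕ → ℕ) → ℝ} {ψ : (ℕ → ℕ) → ℕ → ℝ} (hΦ : DependsOn Φ (Set.Iio n))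
    (hψ : DependsOn ψ (Set.Iio n)) {B : ℝ}
    (hB : ∀ t, |Φ t * (ψ t (t n)
      - ∑ v ∈ Finset.range (n + 1), attachProb a t n v * ψ t v)| ≤ B) :
    ∫ ω, Φ (fun i => T i ω) * (ψ (fun i => T i ω) (T n ω)
      - ∑ v ∈ Finset.range (n + 1), attachProb a (fun i => T i ω) n v * ψ (fun i => T i ω) v) ∂μ
      = 0 := by
  have hp : ∀ {t t' : ℕ → ℕ}, (∀ i ∈ Set.Iio n, t i = t' i) →
      ∀ v, attachProb a t n v = attachProb a t' n v := fun h v => by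
    simp only [attachProb, degree_congr h]
  set F : (ℕ → ℕ) → ℝ := fun t => Φ t * (ψ t (t n)
      - ∑ v ∈ Finset.range (n + 1), attachProb a t n v * ψ t v) with hF
  have hFdep : DependsOn F (Set.Iio (n + 1)) := by
    intro t t' h
    have h' : ∀ i ∈ Set.Iio n, t i = t' i := fun i hi =>
      h i (lt_trans (Set.mem_Iio.1 hi) n.lt_succ_self)
    simp only [hF]
    rw [hΦ h', hψ h', h n (Set.mem_Iio.2 n.lt_succ_self)]
    congr 2
    exact Finset.sum_congr rfl fun v _ => by rw [hp h' v]
  have hFint : Integrable (fun ω => F fun i => T i ω) μ :=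
    Integrable.of_bound (measurable_of_dependsOn hT.measurable hFdep).aestronglyMeasurable B
      (ae_of_all _ fun ω => hB _)
  set A : (Fin n → ℕ) → Set Ω := fun h => {ω | ∀ i < n, T i ω = extendHistory n h i} with hA
  have hAm : ∀ h, MeasurableSet (A h) := fun h => by
    simp only [hA, Set.ofPred_forall]
    exact MeasurableSet.iInter fun i => MeasurableSet.iInter fun _ =>
      hT.measurable i (measurableSet_singleton _)
  have hAd : Pairwise (Function.onFun Disjoint A) := by
    intro h h' hne
    refine Set.disjoint_left.2 fun ω hω hω' => hne (funext fun i => ?_)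
    have h1 := (hω i i.2).symm.trans (hω' i i.2)
    simpa [extendHistory] using h1
  have hAu : ⋃ h, A h = Set.univ := Set.eq_univ_of_forall fun ω =>
    Set.mem_iUnion.2 ⟨fun i => T i ω, fun i hi => by simp [extendHistory, hi]⟩
  change ∫ ω, F (fun i => T i ω) ∂μ = 0
  rw [← setIntegral_univ, ← hAu, integral_iUnion hAm hAd hFint.integrableOn]
  refine (tsum_congr fun h => ?_).trans tsum_zero
  set t := extendHistory n h with ht
  set E : ℕ → Set Ω := fun v => {ω | T n ω = v} with hE
  have hEm : ∀ v, MeasurableSet (E v) := fun v => hT.measurable n (measurableSet_singleton v)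
  set c := ∑ v ∈ Finset.range (n + 1), attachProb a t n v * ψ t v with hc
  have hpt : ∀ᵐ ω ∂μ, ω ∈ A h → F (fun i => T i ω)
      = Φ t * ((∑ v ∈ Finset.range (n + 1), (E v).indicator (fun _ => ψ t v) ω) - c) := by
    filter_upwards [ae_attach_le hT] with ω hω hmem
    have h' : ∀ i ∈ Set.Iio n, (fun i => T i ω) i = t i := fun i hi => hmem i hi
    have hsum : ∑ v ∈ Finset.range (n + 1), (E v).indicator (fun _ => ψ t v) ω
        = ψ t (T n ω) := by
      rw [Finset.sum_eq_single_of_mem (T n ω) (Finset.mem_range.2 (Nat.lt_succ_iff.2 (hω n)))]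
      · simp [hE]
      · intro v _ hv
        exact Set.indicator_of_notMem (fun hmem => hv hmem.symm) _
    simp only [hF]
    rw [hsum, hΦ h', hψ h', hc]
    congr 2
    exact Finset.sum_congr rfl fun v _ => by rw [hp h' v]
  rw [setIntegral_congr_ae (hAm h) hpt, integral_const_mul, integral_sub, integral_finsetSum]
  · have hv : ∀ v, ∫ ω in A h, (E v).indicator (fun _ => ψ t v) ω ∂μ
        = μ.real (A h) * (attachProb a t n v * ψ t v) := by
      intro v
      rw [setIntegral_indicator (hEm v), setIntegral_const, smul_eq_mul, ← mul_assoc,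
        ← hT.attach n hn t v]
      rfl
    simp_rw [hv]
    rw [← Finset.mul_sum, setIntegral_const, smul_eq_mul, sub_self, mul_zero]
  · exact fun v _ => (integrable_const _).indicator (hEm v)
  · exact integrable_finsetSum _ fun v _ => (integrable_const _).indicator (hEm v)
  · exact integrable_const _

/-- For `a > 0`, the conditional expectation of `g` of the excess of the `n`-th chosen
node, given the first `n` attachments. -/
noncomputable def compensator (a : ℝ) (g : ℕ → ℝ) (t : ℕ → ℕ) (n : ℕ) : ℝ :=
  ∑ v ∈ Finset.range (n + 1), attachProb a t n v * g (excess t n v)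

lemma dependsOn_excess (n : ℕ) : DependsOn (fun t => excess t n) (Set.Iio n) := by
  intro t t' h
  funext v
  simp only [excess, degree_congr h]

lemma compensator_eq (a : ℝ) (g : ℕ → ℝ) (t : ℕ → ℕ) (n : ℕ) :
    compensator a g t n
      = (∑ v ∈ Finset.range (n + 1), (excess t n v + a) * g (excess t n v))
        / ((a + 1) * n + a) := by
  rw [compensator, Finset.sum_div]
  refine Finset.sum_congr rfl fun v hv => ?_
  rw [attachProb_eq a t (Nat.lt_succ_iff.1 (Finset.mem_range.1 hv))]
  ring

/-- The averages of `g` along the excesses of the chosen nodes follow the averages of the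
conditional expectations. The bound on `g` makes the weighted terms `attachProb * g` uniformly of
order `1 / n`, which bounds the conditional expectations without summing the degrees. -/
lemma ae_tendsto_average_sub_compensator [IsProbabilityMeasure μ] (ha : 0 < a)
    (hT : IsProcess μ a T) {g : ℕ → ℝ} {K : ℝ} (hg0 : ∀ k, 0 ≤ g k)
    (hgK : ∀ k : ℕ, (k + a) * g k ≤ K) :
    ∀ᵐ ω ∂μ, Tendsto (fun n : ℕ => (∑ i ∈ Finset.range n,
      (g (excess (fun i => T i ω) i (T i ω)) - compensator a g (fun i => T i ω) i)) / n)
      atTop (𝓝 0) := by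
  set X : ℕ → (ℕ → ℕ) → ℝ := fun n t => g (excess t n (t n)) - compensator a g t n with hX
  have hK : 0 ≤ K := le_trans (mul_nonneg (by positivity) (hg0 0)) (hgK 0)
  have hXb : ∀ n t, |X n t| ≤ K / a := by
    intro n t
    have h1 : g (excess t n (t n)) ≤ K / a := by
      rw [le_div_iff₀ ha, mul_comm]
      refine le_trans (mul_le_mul_of_nonneg_right ?_ (hg0 _)) (hgK (excess t n (t n)))
      linarith [(Nat.cast_nonneg (excess t n (t n)) : (0 : ℝ) ≤ _)]
    have h2 : 0 ≤ compensator a g t n := by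
      rw [compensator_eq]
      exact div_nonneg (Finset.sum_nonneg fun v _ => mul_nonneg (by positivity) (hg0 _))
        (by positivity)
    have h3 : compensator a g t n ≤ K / a := by
      rw [compensator_eq, div_le_div_iff₀ (by positivity) ha]
      have h4 : ∑ v ∈ Finset.range (n + 1), (excess t n v + a) * g (excess t n v)
          ≤ (n + 1) * K := by
        refine (Finset.sum_le_sum fun v _ => hgK _).trans_eq ?_
        simp
      have h5 : 0 ≤ K * n := by positivity
      nlinarith [mul_le_mul_of_nonneg_right h4 ha.le]
    rw [abs_le]
    constructor <;> simp only [hX] <;> linarith [hg0 (excess t n (t n))]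
  have hXdep : ∀ n, DependsOn (X n) (Set.Iio (n + 1)) := by
    intro n t t' h
    have h' : ∀ i ∈ Set.Iio n, t i = t' i := fun i hi =>
      h i (lt_trans (Set.mem_Iio.1 hi) n.lt_succ_self)
    have he : excess t n = excess t' n := dependsOn_excess n h'
    simp only [hX, compensator_eq]
    rw [he, h n (Set.mem_Iio.2 n.lt_succ_self)]
  refine ae_tendsto_average_zero (ξ := fun n ω => X n fun i => T i ω) (C := K / a)
    (fun n => measurable_of_dependsOn hT.measurable (hXdep n)) (fun n ω => hXb n _) fun n => ?_
  rcases Nat.eq_zero_or_pos n with rfl | hn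
  · simp
  refine integral_mul_centered_eq_zero hT hn (Φ := fun t => ∑ i ∈ Finset.range n, X i t)
    (ψ := fun t v => g (excess t n v)) (B := (n * (K / a)) * (K / a)) ?_ ?_ ?_
  · intro t t' h
    refine Finset.sum_congr rfl fun i hi => hXdep i fun j hj => h j ?_
    have := Finset.mem_range.1 hi
    have := Set.mem_Iio.1 hj
    exact Set.mem_Iio.2 (by omega)
  · intro t t' h
    funext v
    simp only [show excess t n = excess t' n from dependsOn_excess n h]
  · intro t
    rw [abs_mul]
    refine mul_le_mul ?_ (hXb n t) (abs_nonneg _) (by positivity)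
    refine (Finset.abs_sum_le_sum_abs _ _).trans
      ((Finset.sum_le_sum fun i _ => hXb i t).trans_eq ?_)
    simp

end AttachmentLaw

/-! ### Limits of averages along the attachments -/

lemma eventually_sum_le {x : ℕ → ℝ} {c c' : ℝ} (h : ∀ᶠ i in atTop, x i ≤ c) (hc : c < c') :
    ∀ᶠ n : ℕ in atTop, ∑ i ∈ Finset.range n, x i ≤ c' * n := by
  have h1 : Tendsto (fun i => max (x i) c) atTop (𝓝 c) :=
    tendsto_const_nhds.congr' (h.mono fun i hi => (max_eq_right hi).symm)
  filter_upwards [h1.cesaro.eventually (gt_mem_nhds hc), eventually_gt_atTop 0] with n hn h0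
  have h0' : (0 : ℝ) < n := by exact_mod_cast h0
  rw [inv_mul_eq_div, div_lt_iff₀ h0'] at hn
  exact (Finset.sum_le_sum fun i _ => le_max_left _ _).trans hn.le

lemma eventually_le_sum {x : ℕ → ℝ} {c c' : ℝ} (h : ∀ᶠ i in atTop, c ≤ x i) (hc : c' < c) :
    ∀ᶠ n : ℕ in atTop, c' * n ≤ ∑ i ∈ Finset.range n, x i := by
  have h1 : ∀ᶠ i in atTop, -x i ≤ -c := h.mono fun i hi => neg_le_neg hi
  filter_upwards [eventually_sum_le h1 (neg_lt_neg hc)] with n hn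
  rw [Finset.sum_neg_distrib] at hn
  linarith

lemma compensator_one_div (t : ℕ → ℕ) {a : ℝ} (ha : 0 < a) (n : ℕ) :
    compensator a (fun k => 1 / (a + k)) t n = 1 / (a + (n : ℝ) / (n + 1)) := by
  have h1 : ∀ v ∈ Finset.range (n + 1),
      ((excess t n v : ℝ) + a) * (1 / (a + excess t n v)) = 1 := fun v _ => by
    rw [add_comm a]
    exact mul_one_div_cancel (by positivity)
  rw [compensator_eq, Finset.sum_congr rfl h1]
  simp only [Finset.sum_const, Finset.card_range, nsmul_eq_mul, Nat.cast_add, Nat.cast_one, mul_one]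
  field_simp
  ring

lemma compensator_indicator {t : ℕ → ℕ} (ht : ∀ i, t i ≤ i) (a : ℝ) (n : ℕ) :
    compensator a (fun k => if k = 0 then 1 else 0) t n
      = a * (n + 1 - zeroCount t n) / ((a + 1) * n + a) := by
  rw [compensator_eq, ← sum_excess_eq_zero ht, Finset.mul_sum]
  congr 1
  refine Finset.sum_congr rfl fun v _ => ?_
  split_ifs with h <;> simp [h]

/-- At the true parameter the average of `1 / (a + excess)` has the same limit as the average of
`1 / (a + i / (i + 1))`: the score vanishes asymptotically. -/
lemma tendsto_average_one_div {t : ℕ → ℕ} {a : ℝ} (ha : 0 < a)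
    (h : Tendsto (fun n : ℕ => (∑ i ∈ Finset.range n, (1 / (a + (excess t i (t i) : ℝ))
      - compensator a (fun k => 1 / (a + k)) t i)) / n) atTop (𝓝 0)) :
    Tendsto (fun n : ℕ => (∑ i ∈ Finset.range n, 1 / (a + (excess t i (t i) : ℝ))) / n) atTop
      (𝓝 (1 / (a + 1))) := by
  have h1 : Tendsto (fun n : ℕ => compensator a (fun k => 1 / (a + k)) t n) atTop
      (𝓝 (1 / (a + 1))) := by
    simp_rw [compensator_one_div t ha]
    exact tendsto_const_nhds.div
      (tendsto_const_nhds.add (tendsto_natCast_div_add_atTop (1 : ℝ))) (by positivity)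
  have h2 := h.add h1.cesaro
  rw [zero_add] at h2
  refine h2.congr fun n => ?_
  rw [Finset.sum_sub_distrib, inv_mul_eq_div, ← add_div, sub_add_cancel]

/-- Both the attachments to nodes of excess zero and the others have positive lower density. -/
lemma exists_zeroCount_bounds {t : ℕ → ℕ} (ht : ∀ i, t i ≤ i) {a : ℝ} (ha : 0 < a)
    (h : Tendsto (fun n : ℕ => (∑ i ∈ Finset.range n, ((if excess t i (t i) = 0 then (1 : ℝ) else 0)
      - compensator a (fun k => if k = 0 then 1 else 0) t i)) / n) atTop (𝓝 0)) :
    ∃ c₁ c₂ : ℝ, 0 < c₁ ∧ 0 < c₂ ∧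
      ∀ᶠ n : ℕ in atTop, c₁ * n ≤ zeroCount t n ∧ c₂ * n ≤ n - zeroCount t n := by
  set m : ℕ → ℝ := fun i => compensator a (fun k => if k = 0 then 1 else 0) t i with hm
  have hm_eq : ∀ n : ℕ, m n = a * (n + 1 - zeroCount t n) / ((a + 1) * n + a) :=
    compensator_indicator ht a
  have hdiff : ∀ δ : ℝ, 0 < δ → ∀ᶠ n : ℕ in atTop,
      |zeroCount t n - ∑ i ∈ Finset.range n, m i| ≤ δ * n := by
    intro δ hδ
    have h' := h.abs
    rw [abs_zero] at h'
    filter_upwards [h'.eventually (gt_mem_nhds hδ), eventually_gt_atTop 0] with n hn h0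
    have h0' : (0 : ℝ) < n := by exact_mod_cast h0
    rw [Finset.sum_sub_distrib, abs_div, Nat.abs_cast, div_lt_iff₀ h0'] at hn
    exact hn.le
  have hZ0 : ∀ n, 0 ≤ zeroCount t n := fun n =>
    Finset.sum_nonneg fun i _ => by split_ifs <;> norm_num
  -- The conditional probabilities are at most `a (i + 1) / ((a + 1) i + a)`, whose limit
  -- `a / (a + 1)` is below one.
  have hup : ∀ᶠ i : ℕ in atTop, m i ≤ (a + 1 / 4) / (a + 1) := by
    filter_upwards [eventually_ge_atTop 3] with i hi
    have hi' : (3 : ℝ) ≤ i := by exact_mod_cast hi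
    rw [hm_eq, div_le_div_iff₀ (by positivity) (by positivity)]
    have h1 : a * (i + 1 - zeroCount t i) * (a + 1) ≤ a * (i + 1) * (a + 1) := by
      have := hZ0 i
      gcongr
      linarith
    nlinarith
  have hc2 : ∀ᶠ n : ℕ in atTop, 1 / 4 / (a + 1) * n ≤ n - zeroCount t n := by
    have hlt : (a + 1 / 4) / (a + 1) < (a + 1 / 2) / (a + 1) := by gcongr; norm_num
    filter_upwards [eventually_sum_le hup hlt, hdiff (1 / 4 / (a + 1)) (by positivity)]
      with n h1 h2
    have h3 := (abs_le.1 h2).2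
    have h4 : (n : ℝ) = (a + 1 / 2) / (a + 1) * n + 1 / 4 / (a + 1) * n + 1 / 4 / (a + 1) * n := by
      field_simp
      ring
    linarith
  -- Hence the nodes of excess zero stay a positive proportion, and they keep being chosen.
  set q := a * (1 / 4 / (a + 1)) / (a + 1) with hq
  have hq0 : 0 < q := by positivity
  have hlow : ∀ᶠ i : ℕ in atTop, q ≤ m i := by
    filter_upwards [hc2] with i hi
    rw [hm_eq, hq, div_le_div_iff₀ (by positivity) (by positivity)]
    have h1 : 1 / 4 / (a + 1) ≤ 1 := by
      rw [div_le_one (by positivity)]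
      linarith
    have h2 : 1 / 4 / (a + 1) * (i + 1) ≤ i + 1 - zeroCount t i := by linarith
    calc a * (1 / 4 / (a + 1)) * ((a + 1) * i + a)
        ≤ a * (1 / 4 / (a + 1)) * ((a + 1) * (i + 1)) := by gcongr; linarith
      _ = a * (1 / 4 / (a + 1) * (i + 1)) * (a + 1) := by ring
      _ ≤ a * (i + 1 - zeroCount t i) * (a + 1) := by gcongr
  refine ⟨q / 4, 1 / 4 / (a + 1), by positivity, by positivity, ?_⟩
  filter_upwards [hc2, eventually_le_sum hlow (half_lt_self hq0), hdiff (q / 4) (by positivity)]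
    with n h1 h2 h3
  refine ⟨?_, h1⟩
  have := (abs_le.1 h3).1
  linarith

/-! ### Consistency along a single path -/

section Path

variable {ε M a₀ c₁ c₂ : ℝ} {D : ℕ → ℕ}

/-- To the right of the true parameter the score is eventually negative. -/
lemma eventually_score_neg (hε : 0 < ε) (ha₀ : ε ≤ a₀) (hc₁ : 0 < c₁) (hc₂ : 0 < c₂)
    (hc : ∀ᶠ n : ℕ in atTop, c₁ * n ≤ (∑ i ∈ Finset.range n, if D i = 0 then (1 : ℝ) else 0) ∧
      c₂ * n ≤ n - ∑ i ∈ Finset.range n, if D i = 0 then (1 : ℝ) else 0)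
    (hlim : Tendsto (fun n : ℕ => n / ∑ i ∈ Finset.range n, 1 / (a₀ + (D i : ℝ))) atTop
      (𝓝 (a₀ + 1))) {w : ℝ} (hw : a₀ < w) :
    ∀ᶠ n : ℕ in atTop, ∀ x ∈ Set.Icc w M, ∑ i ∈ Finset.range n, 1 / (x + (D i : ℝ))
      < ∑ i ∈ Finset.range n, 1 / (x + (i : ℝ) / (i + 1)) := by
  rcases le_or_gt w M with hwM | hwM
  swap
  · simp [Set.Icc_eq_empty_of_lt hwM]
  have hM : 0 < M := by linarith
  set η := c₁ * c₂ * (1 / (M * (M + 1))) ^ 2 * ε ^ 2 with hη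
  have hη0 : 0 < η := by positivity
  have hlt : a₀ + 1 - η * (w - a₀) < a₀ + 1 := sub_lt_self _ (mul_pos hη0 (sub_pos.2 hw))
  filter_upwards [hc, hlim.eventually (lt_mem_nhds hlt), eventually_gt_atTop 0]
    with n hn h1 h0 x hx
  have hx0 : 0 < x := by linarith [hx.1]
  have hgrow := harmonicMean_growth hε ha₀ (hw.le.trans hx.1) hx.2 D h0 hc₁.le hc₂.le hn.1 hn.2
  rw [← hη] at hgrow
  have hB : 0 < ∑ i ∈ Finset.range n, 1 / (x + (D i : ℝ)) :=
    Finset.sum_pos (fun i _ => by positivity) (Finset.nonempty_range_iff.2 h0.ne')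
  have h2 : x + 1 < n / ∑ i ∈ Finset.range n, 1 / (x + (D i : ℝ)) := by
    have := mul_le_mul_of_nonneg_left (sub_le_sub_right hx.1 a₀) hη0.le
    linarith
  rw [lt_div_iff₀ hB, ← lt_div_iff₀' (by positivity)] at h2
  refine h2.trans_le ?_
  calc (n : ℝ) / (x + 1) = ∑ i ∈ Finset.range n, 1 / (x + 1) := by simp [div_eq_mul_inv]
    _ ≤ _ := Finset.sum_le_sum fun i _ => one_div_le_one_div_of_le (by positivity) (by
        have : (i : ℝ) / (i + 1) ≤ 1 := div_le_one_of_le₀ (by linarith) (by positivity)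
        linarith)

/-- To the left of the true parameter the score is eventually positive. -/
lemma eventually_score_pos (hε : 0 < ε) (ha₀ : a₀ ≤ M) (hc₁ : 0 < c₁) (hc₂ : 0 < c₂)
    (hc : ∀ᶠ n : ℕ in atTop, c₁ * n ≤ (∑ i ∈ Finset.range n, if D i = 0 then (1 : ℝ) else 0) ∧
      c₂ * n ≤ n - ∑ i ∈ Finset.range n, if D i = 0 then (1 : ℝ) else 0)
    (hlim : Tendsto (fun n : ℕ => n / ∑ i ∈ Finset.range n, 1 / (a₀ + (D i : ℝ))) atTop
      (𝓝 (a₀ + 1))) {w : ℝ} (hw : w < a₀) :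
    ∀ᶠ n : ℕ in atTop, ∀ x ∈ Set.Icc ε w, ∑ i ∈ Finset.range n, 1 / (x + (i : ℝ) / (i + 1))
      < ∑ i ∈ Finset.range n, 1 / (x + (D i : ℝ)) := by
  rcases le_or_gt ε w with hwε | hwε
  swap
  · simp [Set.Icc_eq_empty_of_lt hwε]
  have hM : 0 < M := by linarith
  set η := c₁ * c₂ * (1 / (M * (M + 1))) ^ 2 * ε ^ 2 with hη
  have hη0 : 0 < η := by positivity
  set γ := η * (a₀ - w) / 2 with hγ
  have hγ0 : 0 < γ := div_pos (mul_pos hη0 (sub_pos.2 hw)) two_pos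
  have hρ : 0 < γ / (M + 1) ^ 2 * ε ^ 2 := by positivity
  -- the average of `1 / (x + i / (i + 1))` exceeds its limit `1 / (x + 1)` by `o(1)`
  have hces : ∀ᶠ n : ℕ in atTop, ∑ i ∈ Finset.range n, 1 / ((i : ℝ) + 1)
      < γ / (M + 1) ^ 2 * ε ^ 2 * n := by
    filter_upwards [(tendsto_one_div_add_atTop_nhds_zero_nat (𝕜 := ℝ)).cesaro.eventually
      (gt_mem_nhds hρ), eventually_gt_atTop 0] with n hn h0
    have h0' : (0 : ℝ) < n := by exact_mod_cast h0
    rwa [inv_mul_eq_div, div_lt_iff₀ h0'] at hn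
  filter_upwards [hc, hlim.eventually (gt_mem_nhds (lt_add_of_pos_right _ hγ0)), hces,
    eventually_gt_atTop 0] with n hn h1 h2 h0 x hx
  have hx0 : 0 < x := hε.trans_le hx.1
  have hn0 : (0 : ℝ) < n := by exact_mod_cast h0
  have hgrow := harmonicMean_growth hε hx.1 (hx.2.trans hw.le) ha₀ D h0 hc₁.le hc₂.le hn.1 hn.2
  rw [← hη] at hgrow
  set A := ∑ i ∈ Finset.range n, 1 / (x + (D i : ℝ)) with hA
  have hA0 : 0 < A :=
    Finset.sum_pos (fun i _ => by positivity) (Finset.nonempty_range_iff.2 h0.ne')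
  have h3 : n / A ≤ x + 1 - γ := by
    have := mul_le_mul_of_nonneg_left (sub_le_sub_left hx.2 a₀) hη0.le
    linarith
  rw [div_le_iff₀ hA0] at h3
  have h4 : n / (x + 1) ≤ A := by
    rw [div_le_iff₀' (by positivity)]
    linarith [mul_pos hγ0 hA0]
  have h5 : n / (x + 1) + γ / (M + 1) ^ 2 * n ≤ A := by
    have h6 : γ / (M + 1) ^ 2 * n ≤ γ * A / (x + 1) := by
      calc γ / (M + 1) ^ 2 * n = γ * (n / (M + 1)) / (M + 1) := by field_simp
        _ ≤ γ * (n / (x + 1)) / (x + 1) := by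
            have : x ≤ M := hx.2.trans (hw.le.trans ha₀)
            gcongr
        _ ≤ γ * A / (x + 1) := by gcongr
    have h7 : n / (x + 1) + γ * A / (x + 1) ≤ A := by
      rw [← add_div, div_le_iff₀ (by positivity)]
      linarith
    linarith
  refine lt_of_lt_of_le ?_ h5
  have hterm : ∀ i ∈ Finset.range n, 1 / (x + (i : ℝ) / (i + 1))
      ≤ 1 / (x + 1) + 1 / ((i : ℝ) + 1) / ε ^ 2 := by
    intro i _
    have e1 : 1 / (x + (i : ℝ) / (i + 1)) - 1 / (x + 1)
        = 1 / ((i : ℝ) + 1) / ((x + (i : ℝ) / (i + 1)) * (x + 1)) := by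
      field_simp
      ring
    have e2 : 1 / ((i : ℝ) + 1) / ((x + (i : ℝ) / (i + 1)) * (x + 1))
        ≤ 1 / ((i : ℝ) + 1) / ε ^ 2 := by
      have e3 : ε ≤ x + (i : ℝ) / (i + 1) := hx.1.trans (le_add_of_nonneg_right (by positivity))
      have e4 : ε ≤ x + 1 := by linarith [hx.1]
      rw [sq]
      gcongr
    linarith
  refine (Finset.sum_le_sum hterm).trans_lt ?_
  have e5 : ∑ i ∈ Finset.range n, 1 / (x + 1) = n / (x + 1) := by simp [div_eq_mul_inv]
  have e6 : ∑ i ∈ Finset.range n, 1 / ((i : ℝ) + 1) / ε ^ 2 < γ / (M + 1) ^ 2 * n := by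
    rw [← Finset.sum_div, div_lt_iff₀ (by positivity)]
    linarith
  rw [Finset.sum_add_distrib, e5]
  linarith

end Path

lemma tendsto_of_isMLE {ε M a₀ c₁ c₂ : ℝ} {t : ℕ → ℕ} (ht : ∀ i, t i ≤ i) (hε : 0 < ε)
    (ha₀ : a₀ ∈ Set.Icc ε M) (hc₁ : 0 < c₁) (hc₂ : 0 < c₂)
    (hc : ∀ᶠ n : ℕ in atTop, c₁ * n ≤ zeroCount t n ∧ c₂ * n ≤ n - zeroCount t n)
    (hlim : Tendsto (fun n : ℕ => (∑ i ∈ Finset.range n, 1 / (a₀ + (excess t i (t i) : ℝ))) / n)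
      atTop (𝓝 (1 / (a₀ + 1)))) {b : ℕ → ℝ} (hb : ∀ n, 1 ≤ n → IsMLE ε M t n (b n)) :
    Tendsto b atTop (𝓝 a₀) := by
  have ha0 : 0 < a₀ := hε.trans_le ha₀.1
  have hlim' : Tendsto (fun n : ℕ => n / ∑ i ∈ Finset.range n, 1 / (a₀ + (excess t i (t i) : ℝ)))
      atTop (𝓝 (a₀ + 1)) := by
    have := hlim.inv₀ (by positivity)
    simpa only [inv_div, div_one] using this
  have hcont : ∀ {n : ℕ} {x y : ℝ}, 0 < x → ContinuousOn (logLik t n) (Set.Icc x y) :=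
    fun hx => continuousOn_logLik hx t _
  refine tendsto_order.2 ⟨fun u hu => ?_, fun u hu => ?_⟩
  · filter_upwards [eventually_score_pos hε ha₀.2 hc₁ hc₂ hc hlim'
      (show (u + a₀) / 2 < a₀ by linarith), eventually_ge_atTop 1] with n hn h1
    obtain ⟨hbmem, hbmax⟩ := hb n h1
    by_contra! hle
    have hnR : (0 : ℝ) < n := by exact_mod_cast h1
    have hmono : StrictMonoOn (logLik t n) (Set.Icc (b n) ((u + a₀) / 2)) := by
      refine strictMonoOn_of_deriv_pos (convex_Icc _ _) (hcont (hε.trans_le hbmem.1)) fun x hx => ?_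
      rw [interior_Icc] at hx
      have hx' := hn x ⟨hbmem.1.trans hx.1.le, hx.2.le⟩
      rw [(hasDerivAt_logLik ht n (hε.trans (hbmem.1.trans_lt hx.1))).deriv]
      exact mul_pos (by positivity) (sub_pos.2 hx')
    have hlt : b n < (u + a₀) / 2 := by linarith
    exact (hmono (Set.left_mem_Icc.2 hlt.le) (Set.right_mem_Icc.2 hlt.le) hlt).not_ge
      (hbmax ⟨hbmem.1.trans hlt.le, by linarith [ha₀.2]⟩)
  · filter_upwards [eventually_score_neg (M := M) hε ha₀.1 hc₁ hc₂ hc hlim'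
      (show a₀ < (a₀ + u) / 2 by linarith), eventually_ge_atTop 1] with n hn h1
    obtain ⟨hbmem, hbmax⟩ := hb n h1
    by_contra! hle
    have hnR : (0 : ℝ) < n := by exact_mod_cast h1
    have hanti : StrictAntiOn (logLik t n) (Set.Icc ((a₀ + u) / 2) (b n)) := by
      refine strictAntiOn_of_deriv_neg (convex_Icc _ _) (hcont (by linarith)) fun x hx => ?_
      rw [interior_Icc] at hx
      have hx' := hn x ⟨hx.1.le, hx.2.le.trans hbmem.2⟩
      rw [(hasDerivAt_logLik ht n (by linarith [hx.1])).deriv]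
      exact mul_neg_of_pos_of_neg (by positivity) (sub_neg.2 hx')
    have hlt : (a₀ + u) / 2 < b n := by linarith
    exact (hanti (Set.left_mem_Icc.2 hlt.le) (Set.right_mem_Icc.2 hlt.le) hlt).not_ge
      (hbmax ⟨by linarith [ha₀.1], hlt.le.trans hbmem.2⟩)

end BuckleyOsthus

theorem theorem1 {Ω : Type*} [MeasurableSpace Ω] (μ : Measure Ω) [IsProbabilityMeasure μ]
    (ε M a₀ : ℝ) (hε : 0 < ε) (ha₀ : a₀ ∈ Set.Icc ε M)
    (T : ℕ → Ω → ℕ) (hT : BuckleyOsthus.IsProcess μ a₀ T) :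
    (∀ n : ℕ, 1 ≤ n → ∀ ω, ∃ b, BuckleyOsthus.IsMLE ε M (fun i => T i ω) n b) ∧
    ∀ aHat : ℕ → Ω → ℝ,
      (∀ n : ℕ, 1 ≤ n → ∀ᵐ ω ∂μ, BuckleyOsthus.IsMLE ε M (fun i => T i ω) n (aHat n ω)) →
      ∀ᵐ ω ∂μ, Tendsto (fun n => aHat n ω) atTop (𝓝 a₀) := by
  have ha : 0 < a₀ := hε.trans_le ha₀.1
  refine ⟨fun n _ ω => BuckleyOsthus.exists_isMLE hε (ha₀.1.trans ha₀.2) _ n, fun aHat hHat => ?_⟩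
  have hHat' : ∀ᵐ ω ∂μ, ∀ n : ℕ, 1 ≤ n → BuckleyOsthus.IsMLE ε M (fun i => T i ω) n (aHat n ω) :=
    ae_all_iff.2 fun n => eventually_imp_distrib_left.2 (hHat n)
  have hScore := BuckleyOsthus.ae_tendsto_average_sub_compensator ha hT
    (g := fun k => 1 / (a₀ + k)) (K := 1)
    (fun k => by positivity) fun k => by
      rw [add_comm a₀]
      exact (mul_one_div_cancel (by positivity)).le
  have hZero := BuckleyOsthus.ae_tendsto_average_sub_compensator ha hT
    (g := fun k => if k = 0 then 1 else 0) (K := a₀) (fun k => by split_ifs <;> norm_num) fun k => by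
      split_ifs with h
      · simp [h]
      · simpa using ha.le
  filter_upwards [BuckleyOsthus.ae_attach_le hT, hHat', hScore, hZero] with ω hle hMLE h1 h2
  obtain ⟨c₁, c₂, hc₁, hc₂, hc⟩ := BuckleyOsthus.exists_zeroCount_bounds hle ha h2
  exact BuckleyOsthus.tendsto_of_isMLE hle hε ha₀ hc₁ hc₂ hc
    (BuckleyOsthus.tendsto_average_one_div ha h1) hMLE
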